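/- Let $\Sigma=\{0,1\}^{\mathbb N}$ with the metric $d(x,y)=2^{-n}$, $n$ being the length of the longest common prefix of $x\ne y$; let $\dim$ be the Hausdorff dimension for this metric, $\mathcal F_n$ the set of cylinders $I_{\epsilon_1\dots\epsilon_n}$ of generation $n$, and $I_n(x)$ the cylinder of $\mathcal F_n$ that contains $x\in\Sigma$. Let $\mu$ be an inhomogeneous Bernoulli product on $\Sigma$, that is, a Borel measure for which there are weights $p_j\in(0,1)$, $j\ge 1$, with $\mu(I_{\epsilon_1\dots\epsilon_n})=\prod_{j=1}^n p_j^{1-\epsilon_j}(1-p_j)^{\epsilon_j}$ for all $n$ and all $\epsilon_1,\dots,\epsilon_n\in\{0,1\}$. For $s\in\mathbb R$ put $$\tau_{\mu,n}(s)=\frac1{n\log 2}\log\sum_{I\in\mathcal F_n}\mu(I)^s,\qquad \tau_\mu(s)=\limsup_{n\to\infty}\tau_{\mu,n}(s)\in(-\infty,+\infty],$$ and for $\alpha\in\mathbb R$ put $\tau_\mu^*(\alpha)=\inf_{s\in\mathbb R}\,(\alpha s+\tau_\mu(s))$ and $$E_\alpha=\Big\{x:\liminf_{n\to\infty}\tfrac{-\log\mu(I_n(x))}{n\log2}=\alpha\Big\},\qquad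 F_\alpha=\Big\{x:\limsup_{n\to\infty}\tfrac{-\log\mu(I_n(x))}{n\log2}=\alpha\Big\}.$$ **Theorem 1.2.** Let $q>0$. Suppose that the sequence $(\tau_{\mu,n}(q))_n$ converges and that $\tau_\mu$ (which is finite on $[0,\infty)$) is differentiable at $q$, and put $\alpha=-\tau_\mu'(q)$. Then $$\dim(E_\alpha\cap F_\alpha)=\tau_\mu^*(\alpha)=\alpha q+\tau_\mu(q),$$ and the multifractal formalism holds at $\alpha$, that is, also $\dim E_\alpha=\tau_\mu^*(\alpha)$. -/

import Mathlib

open Filter Topology MeasureTheory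
open scoped ENNReal

namespace BernoulliProduct

noncomputable section

/-- The dyadic Cantor set `Σ = {0,1}^ℕ`. Coordinates are indexed from `0`, so that the `j`-th digit
in the usual numbering is `x (j - 1)`. It carries the product (= Borel) `σ`-algebra. -/
abbrev Cantor : Type := ℕ → Fin 2

/-- The `n`-th generation cylinder `I_{ε₁…εₙ}` of the sequences that begin with `ε₁, …, εₙ`. -/
def wordCylinder {n : ℕ} (ε : Fin n → Fin 2) : Set Cantor :=
  {x | ∀ j : Fin n, x j = ε j}

/-- `I_n(x)`: the `n`-th generation cylinder that contains `x`. -/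
def cylinderAt (n : ℕ) (x : Cantor) : Set Cantor :=
  wordCylinder fun j : Fin n => x j

/-- Hausdorff dimension of a subset of `Σ` for the usual metric `d(x, y) = 2⁻ⁿ`, where `n` is the
length of the longest common prefix of `x ≠ y` (so a cylinder of generation `n` has
diameter `2⁻ⁿ`). -/
def hausdorffDim (s : Set Cantor) : ℝ≥0∞ :=
  letI : MetricSpace Cantor := PiNat.metricSpace (E := fun _ => Fin 2)
  dimH s

/-- `μ` is an inhomogeneous Bernoulli product: there are weights `p_j ∈ (0,1)` such that
`μ(I_{ε₁…εₙ}) = ∏ p_j^{1-ε_j} (1-p_j)^{ε_j}` for every cylinder. -/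
def IsInhomogeneousBernoulliProduct (μ : Measure Cantor) : Prop :=
  ∃ p : ℕ → ℝ, (∀ j, 0 < p j ∧ p j < 1) ∧
    ∀ (n : ℕ) (ε : Fin n → Fin 2),
      μ (wordCylinder ε) =
        ENNReal.ofReal (∏ j : Fin n, p j ^ (1 - (ε j : ℕ)) * (1 - p j) ^ (ε j : ℕ))

/-- `τ_{μ,n}(q) = (1 / (n log 2)) log ∑ μ(I)^q`, the sum being over the cylinders `I` of
generation `n` with `μ(I) ≠ 0`. -/
def tauN (μ : Measure Cantor) (n : ℕ) (q : ℝ) : ℝ :=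
  open scoped Classical in
  1 / (n * Real.log 2) *
    Real.log (∑ ε : Fin n → Fin 2 with μ (wordCylinder ε) ≠ 0, (μ (wordCylinder ε)).toReal ^ q)

/-- The `L^q`-spectrum `τ_μ(q) = limsup τ_{μ,n}(q)`, with values in `[-∞, +∞]`. For an inhomogeneous
Bernoulli product it is finite on `[0, ∞)`, and it may be `+∞` at negative `q`. -/
def tau (μ : Measure Cantor) (q : ℝ) : EReal :=
  limsup (fun n => (tauN μ n q : EReal)) atTop

/-- The Legendre transform `τ_μ*(α) = inf {α q + τ_μ(q) : q ∈ ℝ}`. -/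
def tauStar (μ : Measure Cantor) (α : ℝ) : EReal :=
  ⨅ q : ℝ, ((α * q : ℝ) : EReal) + tau μ q

/-- `α_n(x) = - log μ(I_n(x)) / (n log 2)`, equal to `+∞` where `μ(I_n(x)) = 0`. -/
def alphaN (μ : Measure Cantor) (n : ℕ) (x : Cantor) : EReal :=
  open scoped Classical in
  if μ (cylinderAt n x) = 0 then ⊤
  else ((-Real.log (μ (cylinderAt n x)).toReal / (n * Real.log 2) : ℝ) : EReal)

/-- `E_α`: the points whose lower local dimension `liminf α_n(x)` equals `α`. -/
def levelSetE (μ : Measure Cantor) (α : ℝ) : Set Cantor :=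
  {x | liminf (fun n => alphaN μ n x) atTop = (α : EReal)}

/-- `F_α`: the points whose upper local dimension `limsup α_n(x)` equals `α`. -/
def levelSetF (μ : Measure Cantor) (α : ℝ) : Set Cantor :=
  {x | limsup (fun n => alphaN μ n x) atTop = (α : EReal)}

end

end BernoulliProduct

/-!
Write `l` for the limit of `τ_n(q)`, which is `τ(q)`. The proof rests on the Gibbs measure `ν` at
`q`, that is, the product measure with `ν(I) = μ(I)^q 2^(-n τ_n(q))` on the cylinders `I` of
generation `n` (`exists_gibbsMeasure`).

*Law of large numbers.* The exponential moments of `-log μ(I_n(x))` under `ν` are quotients of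
partition sums, so `ν {x | -r α_n(x) ≥ c} ≤ 2^(n (τ_n(q + r) - τ_n(q) - c))` by Markov's inequality
(`HasWeights.gibbs_tail_le`). Since `τ_n(q)` converges and `τ` has derivative `-α` at `q`, the
exponent is negative for `c = -r α + |r| ε` and small `r` of either sign, and the Borel–Cantelli
lemma gives `α_n(x) → α` for `ν`-almost every `x`
(`HasWeights.ae_tendsto_wordExponent`). No variance estimate is needed.

*Lower bound.* At such points `ν(I_n(x)) = 2^(-n (q α_n(x) + τ_n(q)))`, so `ν` has local dimension
`α q + l` there, and the mass distribution principle
(`le_hausdorffDim_of_measure_cylinderAt_le`) bounds `dim (E_α ∩ F_α)` from below.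

*Upper bound.* As `q > 0`, at most `2^(n (q (α + δ) + τ_n(q)))` cylinders of generation `n` have
`μ(I) ≥ 2^(-n (α + δ))`, and every point of `E_α` lies in infinitely many of these
(`HasWeights.hausdorffDim_levelSetE_le`).

*Legendre transform.* Each `τ_n` is convex by Hölder's inequality. A `limsup` of convex functions
is convex along segments from `q` because `τ_n(q)` converges, so the tangent to `τ` at `q` lies below
`τ`, and the infimum defining `τ*(α)` is attained at `q` (`HasWeights.tauStar_eq`).
-/

namespace BernoulliProduct

/-! ### Hausdorff dimension through cylinders -/

section

attribute [local instance] PiNat.metricSpace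

theorem mem_cylinderAt {n : ℕ} {x y : Cantor} : y ∈ cylinderAt n x ↔ ∀ j < n, y j = x j := by
  constructor
  · intro h j hj
    exact h ⟨j, hj⟩
  · intro h j
    exact h j j.2

theorem mem_cylinderAt_iff_edist_le {n : ℕ} {x y : Cantor} :
    y ∈ cylinderAt n x ↔ edist y x ≤ (2⁻¹ : ℝ≥0∞) ^ n := by
  have h : (2⁻¹ : ℝ≥0∞) ^ n = ENNReal.ofReal ((1 / 2) ^ n) := by
    rw [ENNReal.ofReal_pow (by norm_num), one_div, ENNReal.ofReal_inv_of_pos (by norm_num)]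
    simp
  rw [h, edist_dist, ENNReal.ofReal_le_ofReal_iff (by positivity),
    ← PiNat.mem_cylinder_iff_dist_le, mem_cylinderAt]
  rfl

theorem ediam_wordCylinder_le {n : ℕ} (ε : Fin n → Fin 2) :
    Metric.ediam (wordCylinder ε) ≤ (2⁻¹ : ℝ≥0∞) ^ n := by
  refine Metric.ediam_le fun x hx y hy => ?_
  rw [← mem_cylinderAt_iff_edist_le]
  intro j
  exact (hx j).trans (hy j).symm

theorem tendsto_two_inv_pow : Tendsto (fun n : ℕ => (2⁻¹ : ℝ≥0∞) ^ n) atTop (𝓝 0) :=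
  ENNReal.tendsto_pow_atTop_nhds_zero_of_lt_one (by simp)

theorem tendsto_two_inv_pow_rpow {d : ℝ} (hd : 0 < d) :
    Tendsto (fun n : ℕ => ((2⁻¹ : ℝ≥0∞) ^ n) ^ d) atTop (𝓝 0) := by
  have := tendsto_two_inv_pow.ennrpow_const d
  rwa [ENNReal.zero_rpow_of_pos hd] at this

/-- Covering bound: `W n` lists words of length `n`, and the cylinders of the `W n` with `n ≥ N`
cover `s` for every `N`. -/
theorem hausdorffDim_le_of_cover {s : Set Cantor} {d : NNReal}
    (W : ∀ n : ℕ, Finset (Fin n → Fin 2))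
    (hcov : ∀ x ∈ s, ∃ᶠ n : ℕ in atTop, (fun j : Fin n => x j) ∈ W n)
    (hsum : ∑' n : ℕ, ((W n).card : ℝ≥0∞) * ((2⁻¹ : ℝ≥0∞) ^ n) ^ (d : ℝ) ≠ ∞) :
    hausdorffDim s ≤ d := by
  borelize Cantor
  refine dimH_le_of_hausdorffMeasure_ne_top (ne_top_of_le_ne_top hsum ?_)
  refine (Measure.hausdorffMeasure_le_liminf_tsum (ι := fun N : ℕ => Σ k : ℕ, W (k + N))
    (d : ℝ) s (l := atTop) (fun N => (2⁻¹ : ℝ≥0∞) ^ N) tendsto_two_inv_pow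
    (fun N i => wordCylinder i.2.1) (Eventually.of_forall fun N i => ?_)
    (Eventually.of_forall fun N x hx => ?_)).trans ?_
  · exact (ediam_wordCylinder_le _).trans
      (pow_le_pow_right_of_le_one' (by simp) (Nat.le_add_left _ _))
  · obtain ⟨n, hn, hxn⟩ := (frequently_atTop.1 (hcov x hx)) N
    obtain ⟨k, rfl⟩ := Nat.exists_eq_add_of_le' hn
    exact Set.mem_iUnion.2 ⟨⟨k, _, hxn⟩, fun _ => rfl⟩
  · refine liminf_le_of_le (by isBoundedDefault) fun b hb => ?_
    obtain ⟨N, hN⟩ := hb.exists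
    refine hN.trans ?_
    rw [ENNReal.tsum_sigma']
    refine le_trans (ENNReal.tsum_le_tsum fun k => ?_)
      (ENNReal.tsum_comp_le_tsum_of_injective (add_left_injective N)
        fun n : ℕ => ((W n).card : ℝ≥0∞) * ((2⁻¹ : ℝ≥0∞) ^ n) ^ (d : ℝ))
    rw [tsum_fintype]
    refine (Finset.sum_le_card_nsmul _ _ (((2⁻¹ : ℝ≥0∞) ^ (k + N)) ^ (d : ℝ))
      fun w _ => ?_).trans ?_
    · exact ENNReal.rpow_le_rpow (ediam_wordCylinder_le _) d.2
    · simp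

/-- A set of sequences that is described by the first `n` digits is measurable. -/
theorem measurableSet_prefix (n : ℕ) (A : Set (Fin n → Fin 2)) :
    MeasurableSet {x : Cantor | (fun j : Fin n => x j) ∈ A} :=
  (measurable_pi_lambda _ fun _ => measurable_pi_apply _) (Set.toFinite A).measurableSet

/-- Mass distribution principle. The bound on the mass of cylinders is uniform on each set `A N`
of the proof, and some `s ∩ A N` has positive mass. -/
theorem le_hausdorffDim_of_measure_cylinderAt_le {ν : Measure Cantor} {s : Set Cantor}
    (hs : ν s ≠ 0) {d : NNReal}
    (h : ∀ x ∈ s, ∀ᶠ n : ℕ in atTop, ν (cylinderAt n x) ≤ ((2⁻¹ : ℝ≥0∞) ^ n) ^ (d : ℝ)) :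
    d ≤ hausdorffDim s := by
  rcases eq_or_lt_of_le d.2 with hd | hd
  · have : d = 0 := NNReal.eq hd.symm
    simp [this]
  have hd : 0 < (d : ℝ) := hd
  have : BorelSpace Cantor := Pi.borelSpace
  have hdim : dimH s = hausdorffDim s := rfl
  let A : ℕ → Set Cantor := fun N =>
    {x | ∀ n ≥ N, ν (cylinderAt n x) ≤ ((2⁻¹ : ℝ≥0∞) ^ n) ^ (d : ℝ)}
  have hA : ∀ N, MeasurableSet (A N) := fun N => by
    have : A N = ⋂ n, ⋂ (_ : n ≥ N), {x : Cantor | (fun j : Fin n => x j) ∈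
        {ε : Fin n → Fin 2 | ν (wordCylinder ε) ≤ ((2⁻¹ : ℝ≥0∞) ^ n) ^ (d : ℝ)}} := by
      ext x; simp [A, cylinderAt]
    rw [this]
    exact MeasurableSet.iInter fun n => MeasurableSet.iInter fun _ => measurableSet_prefix n _
  obtain ⟨N, hN⟩ : ∃ N, ν (s ∩ A N) ≠ 0 := by
    by_contra! hcon
    refine hs (measure_mono_null (fun x hx => ?_) (measure_iUnion_null hcon))
    obtain ⟨N, hN⟩ := eventually_atTop.1 (h x hx)
    exact Set.mem_iUnion.2 ⟨N, hx, hN⟩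
  have hle : ν.restrict (A N) ≤ Measure.hausdorffMeasure (d : ℝ) := by
    refine Measure.le_hausdorffMeasure _ _ ((2⁻¹ : ℝ≥0∞) ^ N)
      (ENNReal.pow_pos (by simp) N) fun t ht => ?_
    rw [Measure.restrict_apply' (hA N)]
    rcases Set.eq_empty_or_nonempty (t ∩ A N) with he | ⟨x, hxt, hxA⟩
    · simp [he]
    by_cases hsub : ∀ n, t ⊆ cylinderAt (n + 1) x
    · -- `t` is a single point, whose cylinders have measure tending to `0`
      refine le_trans ?_ zero_le
      refine ge_of_tendsto (tendsto_two_inv_pow_rpow hd) ?_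
      filter_upwards [eventually_ge_atTop (N + 1)] with n hn
      obtain ⟨k, rfl⟩ := Nat.exists_eq_add_of_le' (show 1 ≤ n by omega)
      exact (measure_mono (Set.inter_subset_left.trans (hsub k))).trans (hxA _ (by omega))
    · rw [not_forall] at hsub
      classical
      -- `n` is the largest generation with `t` inside the cylinder of `x`
      set n := Nat.find hsub with hn
      have h1 : ¬ t ⊆ cylinderAt (n + 1) x := Nat.find_spec hsub
      have h2 : t ⊆ cylinderAt n x := by
        rcases Nat.eq_zero_or_pos n with h0 | h0
        · intro y _
          rw [h0, mem_cylinderAt]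
          simp
        · obtain ⟨k, hk⟩ := Nat.exists_eq_add_of_le' h0
          have := Nat.find_min hsub (m := k) (by omega)
          rw [not_not] at this
          rwa [hk]
      obtain ⟨y, hyt, hy⟩ := Set.not_subset.1 h1
      have hNn : N ≤ n := by
        by_contra! hlt
        refine hy (mem_cylinderAt_iff_edist_le.2 ?_)
        refine ((Metric.edist_le_ediam_of_mem hyt hxt).trans ht).trans ?_
        exact pow_le_pow_right_of_le_one' (by simp) (by omega)
      have hdiam : (2⁻¹ : ℝ≥0∞) ^ n ≤ Metric.ediam t := by
        refine le_trans ?_ (Metric.edist_le_ediam_of_mem hyt hxt)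
        have hyx : y ≠ x := by
          rintro rfl
          exact hy (mem_cylinderAt.2 fun _ _ => rfl)
        have hfd : PiNat.firstDiff y x ≤ n := by
          by_contra! hlt
          exact hy (mem_cylinderAt.2 fun j hj =>
            PiNat.apply_eq_of_lt_firstDiff (by omega))
        rw [edist_dist, PiNat.dist_eq_of_ne hyx, ENNReal.ofReal_pow (by norm_num), one_div,
          ENNReal.ofReal_inv_of_pos (by norm_num), ENNReal.ofReal_ofNat]
        exact pow_le_pow_right_of_le_one' (by simp) hfd
      calc ν (t ∩ A N) ≤ ν (cylinderAt n x) := measure_mono (Set.inter_subset_left.trans h2)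
        _ ≤ ((2⁻¹ : ℝ≥0∞) ^ n) ^ (d : ℝ) := hxA n hNn
        _ ≤ _ := ENNReal.rpow_le_rpow hdiam d.2
  rw [← hdim]
  refine le_dimH_of_hausdorffMeasure_ne_zero fun h0 => hN ?_
  have := hle s
  rw [h0, Measure.restrict_apply' (hA N)] at this
  exact le_antisymm this zero_le

theorem hausdorffDim_mono {s t : Set Cantor} (h : s ⊆ t) : hausdorffDim s ≤ hausdorffDim t :=
  dimH_mono h

end

/-! ### Weights of words and partition sums -/

/-- The weight `∏ P_j(ε_j)` of a word, `P` being a sequence of weights on the digits. -/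
noncomputable def wordWeight (P : ℕ → Fin 2 → ℝ) {n : ℕ} (ε : Fin n → Fin 2) : ℝ :=
  ∏ j : Fin n, P j (ε j)

/-- The partition sum `∑ w(ε)^s` over the words of length `n`. -/
noncomputable def partitionSum (P : ℕ → Fin 2 → ℝ) (n : ℕ) (s : ℝ) : ℝ :=
  ∑ ε : Fin n → Fin 2, wordWeight P ε ^ s

/-- The exponent `a` for which the word has weight `2 ^ (-n a)`. For the empty word it is `0`, by
division by zero, and the formula remains true. -/
noncomputable def wordExponent (P : ℕ → Fin 2 → ℝ) {n : ℕ} (ε : Fin n → Fin 2) : ℝ :=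
  -Real.log (wordWeight P ε) / (n * Real.log 2)

section
variable {P : ℕ → Fin 2 → ℝ}

theorem wordWeight_pos (hP : ∀ j e, 0 < P j e) {n : ℕ} (ε : Fin n → Fin 2) :
    0 < wordWeight P ε :=
  Finset.prod_pos fun j _ => hP j (ε j)

theorem partitionSum_pos (hP : ∀ j e, 0 < P j e) (n : ℕ) (s : ℝ) : 0 < partitionSum P n s :=
  Finset.sum_pos (fun ε _ => Real.rpow_pos_of_pos (wordWeight_pos hP ε) s) Finset.univ_nonempty

theorem partitionSum_eq_prod (hP : ∀ j e, 0 < P j e) (n : ℕ) (s : ℝ) :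
    partitionSum P n s = ∏ j : Fin n, ∑ e, P j e ^ s := by
  rw [Finset.prod_univ_sum, Fintype.piFinset_univ]
  refine Finset.sum_congr rfl fun ε _ => ?_
  exact (Real.finsetProd_rpow _ (fun j : Fin n => P j (ε j)) (fun j _ => (hP j (ε j)).le) s).symm

theorem wordWeight_eq_rpow (hP : ∀ j e, 0 < P j e) {n : ℕ} (ε : Fin n → Fin 2) :
    wordWeight P ε = 2 ^ (-(n * wordExponent P ε)) := by
  rcases Nat.eq_zero_or_pos n with rfl | hn
  · simp [wordWeight]
  · have hn' : (n : ℝ) ≠ 0 := by positivity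
    have h2 : Real.log 2 ≠ 0 := (Real.log_pos one_lt_two).ne'
    rw [Real.rpow_def_of_pos two_pos, wordExponent]
    field_simp
    simp [Real.exp_log (wordWeight_pos hP ε)]

/-- Hölder's inequality for the partition sums. -/
theorem partitionSum_holder (hP : ∀ j e, 0 < P j e) (n : ℕ) (a b : ℝ) {t : ℝ} (h0 : 0 < t)
    (h1 : t < 1) :
    partitionSum P n ((1 - t) * a + t * b) ≤
      partitionSum P n a ^ (1 - t) * partitionSum P n b ^ t := by
  have hpq : Real.HolderConjugate (1 - t)⁻¹ t⁻¹ :=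
    Real.holderConjugate_iff.2 ⟨(one_lt_inv₀ (by linarith)).2 (by linarith), by simp⟩
  have h := Real.inner_le_Lp_mul_Lq_of_nonneg (Finset.univ : Finset (Fin n → Fin 2)) hpq
    (f := fun ε => wordWeight P ε ^ ((1 - t) * a)) (g := fun ε => wordWeight P ε ^ (t * b))
    (fun ε _ => (Real.rpow_pos_of_pos (wordWeight_pos hP ε) _).le)
    (fun ε _ => (Real.rpow_pos_of_pos (wordWeight_pos hP ε) _).le)
  have ht : 1 - t ≠ 0 := by linarith
  have e1 : ∀ ε : Fin n → Fin 2,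
      (wordWeight P ε ^ ((1 - t) * a)) ^ (1 - t)⁻¹ = wordWeight P ε ^ a := fun ε => by
    rw [← Real.rpow_mul (wordWeight_pos hP ε).le]
    congr 1
    field_simp
  have e2 : ∀ ε : Fin n → Fin 2,
      (wordWeight P ε ^ (t * b)) ^ t⁻¹ = wordWeight P ε ^ b := fun ε => by
    rw [← Real.rpow_mul (wordWeight_pos hP ε).le]
    congr 1
    field_simp
  simp only [e1, e2, ← Real.rpow_add (wordWeight_pos hP _), one_div, inv_inv] at h
  exact h

theorem partitionSum_le (hP : ∀ j e, 0 < P j e) (hsum : ∀ j, ∑ e, P j e = 1) (n : ℕ) {s : ℝ}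
    (hs : 0 ≤ s) : partitionSum P n s ≤ 2 ^ n := by
  have h1 : ∀ j e, P j e ≤ 1 := fun j e =>
    (hsum j) ▸ Finset.single_le_sum (fun i _ => (hP j i).le) (Finset.mem_univ e)
  refine (Finset.sum_le_card_nsmul _ _ 1 fun ε _ => ?_).trans (by simp)
  exact Real.rpow_le_one (wordWeight_pos hP ε).le
    (Finset.prod_le_one (fun j _ => (hP _ _).le) fun j _ => h1 _ _) hs

theorem le_partitionSum (hP : ∀ j e, 0 < P j e) (hsum : ∀ j, ∑ e, P j e = 1) (n : ℕ) {s : ℝ}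
    (hs : 0 ≤ s) : ((1 / 2 : ℝ) ^ s) ^ n ≤ partitionSum P n s := by
  rw [partitionSum_eq_prod hP]
  refine le_trans (by simp) (Finset.prod_le_prod (s := Finset.univ)
    (f := fun _ : Fin n => (1 / 2 : ℝ) ^ s) (fun _ _ => by positivity) fun j _ => ?_)
  have hj := hsum j
  have p0 := hP j 0
  have p1 := hP j 1
  rw [Fin.sum_univ_two] at hj ⊢
  have r0 := Real.rpow_pos_of_pos p0 s
  have r1 := Real.rpow_pos_of_pos p1 s
  -- one of the two weights is at least `1/2`
  rcases le_total (1 / 2) (P j 0) with h | h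
  · have := Real.rpow_le_rpow (by norm_num) h hs
    linarith
  · have := Real.rpow_le_rpow (by norm_num) (show 1 / 2 ≤ P j 1 by linarith) hs
    linarith

end

/-- `P` is a sequence of positive probability weights on the digits, and `μ` gives every cylinder
the weight of its word. -/
structure HasWeights (μ : Measure Cantor) (P : ℕ → Fin 2 → ℝ) : Prop where
  pos : ∀ j e, 0 < P j e
  sum_eq_one : ∀ j, ∑ e, P j e = 1
  measure_wordCylinder : ∀ (n : ℕ) (ε : Fin n → Fin 2),
    μ (wordCylinder ε) = ENNReal.ofReal (wordWeight P ε)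

theorem IsInhomogeneousBernoulliProduct.exists_hasWeights {μ : Measure Cantor}
    (hμ : IsInhomogeneousBernoulliProduct μ) : ∃ P : ℕ → Fin 2 → ℝ, HasWeights μ P := by
  obtain ⟨p, hp, h⟩ := hμ
  refine ⟨fun j e => p j ^ (1 - (e : ℕ)) * (1 - p j) ^ (e : ℕ), fun j e => ?_, fun j => ?_, h⟩
  · have := hp j
    exact mul_pos (pow_pos this.1 _) (pow_pos (by linarith) _)
  · simp

/-- A product measure with prescribed positive weights. -/
theorem exists_productMeasure {w : ℕ → Fin 2 → ℝ} (hw : ∀ j e, 0 < w j e)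
    (hsum : ∀ j, ∑ e, w j e = 1) :
    ∃ ν : Measure Cantor, IsProbabilityMeasure ν ∧ HasWeights ν w := by
  let κ : ℕ → Measure (Fin 2) := fun j => ∑ e, ENNReal.ofReal (w j e) • Measure.dirac e
  have hκ : ∀ j e, κ j {e} = ENNReal.ofReal (w j e) := fun j e => by
    simp [κ, Set.indicator_apply]
    fin_cases e <;> simp
  have hprob : ∀ j, IsProbabilityMeasure (κ j) := fun j => ⟨by
    simp only [κ, Measure.coe_finsetSum, Finset.sum_apply, Measure.smul_apply, measure_univ,
      smul_eq_mul, mul_one]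
    rw [← ENNReal.ofReal_sum_of_nonneg fun e _ => (hw j e).le, hsum, ENNReal.ofReal_one]⟩
  refine ⟨Measure.infinitePi κ, inferInstance, hw, hsum, fun n ε => ?_⟩
  have hset : wordCylinder ε = Set.pi (Finset.range n)
      fun j => {e | ∀ h : j < n, e = ε ⟨j, h⟩} := by
    ext x
    simp only [wordCylinder, Set.mem_ofPred_eq, Set.mem_pi, Finset.coe_range, Set.mem_Iio]
    exact ⟨fun h j hj _ => h ⟨j, hj⟩, fun h j => h j j.2 j.2⟩
  rw [hset, Measure.infinitePi_pi _ fun j _ => (Set.toFinite _).measurableSet,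
    Finset.prod_range, wordWeight, ENNReal.ofReal_prod_of_nonneg fun j _ => (hw _ _).le]
  refine Finset.prod_congr rfl fun j _ => ?_
  rw [← hκ]
  congr 1
  ext e
  simp

/-- `ν` is the Gibbs measure of the weights `P` at the parameter `q`: it gives a cylinder the mass
`w(ε)^q / ∑ w(ε')^q`. -/
def IsGibbsMeasure (ν : Measure Cantor) (P : ℕ → Fin 2 → ℝ) (q : ℝ) : Prop :=
  ∀ (n : ℕ) (ε : Fin n → Fin 2),
    ν (wordCylinder ε) = ENNReal.ofReal (wordWeight P ε ^ q / partitionSum P n q)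

/-- The Gibbs measure is the product measure with the digit weights `P_j(e)^q / ∑ P_j(e')^q`. -/
theorem exists_gibbsMeasure {P : ℕ → Fin 2 → ℝ} (hP : ∀ j e, 0 < P j e) (q : ℝ) :
    ∃ ν : Measure Cantor, IsProbabilityMeasure ν ∧ IsGibbsMeasure ν P q := by
  have hpos : ∀ j, 0 < ∑ e, P j e ^ q := fun j =>
    Finset.sum_pos (fun e _ => Real.rpow_pos_of_pos (hP j e) q) Finset.univ_nonempty
  obtain ⟨ν, hν, h⟩ := exists_productMeasure (w := fun j e => P j e ^ q / ∑ e', P j e' ^ q)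
    (fun j e => div_pos (Real.rpow_pos_of_pos (hP j e) q) (hpos j))
    (fun j => by rw [← Finset.sum_div, div_self (hpos j).ne'])
  refine ⟨ν, hν, fun n ε => ?_⟩
  rw [h.measure_wordCylinder, partitionSum_eq_prod hP, wordWeight, wordWeight, Finset.prod_div_distrib,
    Real.finsetProd_rpow _ (fun j : Fin n => P j (ε j)) (fun j _ => (hP j (ε j)).le)]

/-! ### The `L^q`-spectrum -/

section
variable {μ : Measure Cantor} {P : ℕ → Fin 2 → ℝ}

theorem HasWeights.tauN_eq (h : HasWeights μ P) (n : ℕ) (s : ℝ) :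
    tauN μ n s = 1 / (n * Real.log 2) * Real.log (partitionSum P n s) := by
  have h' : ∀ ε : Fin n → Fin 2, μ (wordCylinder ε) ≠ 0 := fun ε => by
    rw [h.measure_wordCylinder]
    exact (ENNReal.ofReal_pos.2 (wordWeight_pos h.pos ε)).ne'
  rw [tauN, Finset.filter_true_of_mem fun ε _ => h' ε]
  simp only [h.measure_wordCylinder, ENNReal.toReal_ofReal (wordWeight_pos h.pos _).le]
  rfl

theorem HasWeights.alphaN_eq (h : HasWeights μ P) (n : ℕ) (x : Cantor) :
    alphaN μ n x = (wordExponent P (fun j : Fin n => x j) : EReal) := by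
  have h' : μ (cylinderAt n x) = ENNReal.ofReal (wordWeight P fun j : Fin n => x j) :=
    h.measure_wordCylinder n _
  rw [alphaN, if_neg, h', ENNReal.toReal_ofReal (wordWeight_pos h.pos _).le]
  · rfl
  · rw [h']
    exact (ENNReal.ofReal_pos.2 (wordWeight_pos h.pos _)).ne'

theorem HasWeights.partitionSum_eq_rpow (h : HasWeights μ P) (n : ℕ) (s : ℝ) :
    partitionSum P n s = 2 ^ (n * tauN μ n s) := by
  rcases Nat.eq_zero_or_pos n with rfl | hn
  · simp [partitionSum, wordWeight]
  · have hn' : (n : ℝ) ≠ 0 := by positivity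
    have h2 : Real.log 2 ≠ 0 := (Real.log_pos one_lt_two).ne'
    rw [Real.rpow_def_of_pos two_pos, h.tauN_eq]
    field_simp
    rw [Real.exp_log (partitionSum_pos h.pos n s)]

theorem HasWeights.tauN_convex (h : HasWeights μ P) (n : ℕ) (a b : ℝ) {t : ℝ}
    (h0 : 0 < t) (h1 : t < 1) :
    tauN μ n ((1 - t) * a + t * b) ≤ (1 - t) * tauN μ n a + t * tauN μ n b := by
  have h' := Real.log_le_log (partitionSum_pos h.pos n _) (partitionSum_holder h.pos n a b h0 h1)
  have pa := partitionSum_pos h.pos n a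
  have pb := partitionSum_pos h.pos n b
  rw [Real.log_mul (Real.rpow_pos_of_pos pa _).ne' (Real.rpow_pos_of_pos pb _).ne',
    Real.log_rpow pa, Real.log_rpow pb] at h'
  simp only [h.tauN_eq]
  have h2 : 0 < Real.log 2 := Real.log_pos one_lt_two
  refine (mul_le_mul_of_nonneg_left h' (by positivity)).trans (le_of_eq ?_)
  ring

theorem HasWeights.tauN_le_one (h : HasWeights μ P) (n : ℕ) {s : ℝ} (hs : 0 ≤ s) :
    tauN μ n s ≤ 1 := by
  rcases Nat.eq_zero_or_pos n with rfl | hn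
  · simp [tauN]
  have h' := partitionSum_le h.pos h.sum_eq_one n hs
  rw [h.partitionSum_eq_rpow, ← Real.rpow_natCast, Real.rpow_le_rpow_left_iff one_lt_two] at h'
  have hn' : (0 : ℝ) < n := by positivity
  nlinarith

theorem HasWeights.neg_le_tauN (h : HasWeights μ P) (n : ℕ) {s : ℝ} (hs : 0 ≤ s) :
    -s ≤ tauN μ n s := by
  rcases Nat.eq_zero_or_pos n with rfl | hn
  · simpa [tauN] using hs
  have h' := le_partitionSum h.pos h.sum_eq_one n hs
  rw [h.partitionSum_eq_rpow, one_div, Real.inv_rpow two_pos.le, ← Real.rpow_neg two_pos.le,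
    ← Real.rpow_mul_natCast two_pos.le, Real.rpow_le_rpow_left_iff one_lt_two] at h'
  have hn' : (0 : ℝ) < n := by positivity
  nlinarith

/-- `τ_μ` is finite on `[0, ∞)`. -/
theorem HasWeights.coe_toReal_tau (h : HasWeights μ P) {s : ℝ} (hs : 0 ≤ s) :
    (((tau μ s).toReal : ℝ) : EReal) = tau μ s := by
  refine EReal.coe_toReal (ne_top_of_le_ne_top (EReal.coe_ne_top 1) ?_)
    (ne_bot_of_le_ne_bot (EReal.coe_ne_bot (-s)) ?_)
  · exact limsup_le_of_le (by isBoundedDefault)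
      (Eventually.of_forall fun n => EReal.coe_le_coe_iff.2 (h.tauN_le_one n hs))
  · refine le_limsup_of_frequently_le (Frequently.of_forall fun n => ?_) (by isBoundedDefault)
    exact EReal.coe_le_coe_iff.2 (h.neg_le_tauN n hs)

end

theorem eventually_tauN_lt {μ : Measure Cantor} {s c : ℝ} (h : tau μ s < c) :
    ∀ᶠ n in atTop, tauN μ n s < c := by
  filter_upwards [eventually_lt_of_limsup_lt h (by isBoundedDefault)] with n hn
  exact EReal.coe_lt_coe_iff.1 hn

theorem tau_eq_of_tendsto {μ : Measure Cantor} {q l : ℝ}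
    (hlim : Tendsto (fun n => tauN μ n q) atTop (𝓝 l)) : tau μ q = l :=
  ((continuous_coe_real_ereal.tendsto l).comp hlim).limsup_eq

/-- Convexity of `τ` on segments that start at a point `q` where `τ_n(q)` converges: the `limsup` of
the sum in the convexity inequality for `τ_n` then splits. -/
theorem HasWeights.tau_convex_le {μ : Measure Cantor} {P : ℕ → Fin 2 → ℝ} (h : HasWeights μ P)
    {q l s c t : ℝ} (hlim : Tendsto (fun n => tauN μ n q) atTop (𝓝 l)) (hc : tau μ s < c)
    (h0 : 0 < t) (h1 : t < 1) :
    tau μ ((1 - t) * q + t * s) ≤ (((1 - t) * l + t * c : ℝ) : EReal) := by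
  have hlim' : Tendsto (fun n => (1 - t) * tauN μ n q + t * c) atTop (𝓝 ((1 - t) * l + t * c)) :=
    (hlim.const_mul _).add_const _
  rw [← ((continuous_coe_real_ereal.tendsto _).comp hlim').limsup_eq]
  refine limsup_le_limsup ?_ (by isBoundedDefault) (by isBoundedDefault)
  filter_upwards [eventually_tauN_lt hc] with n hn
  refine EReal.coe_le_coe_iff.2 ((h.tauN_convex n q s h0 h1).trans ?_)
  have := mul_le_mul_of_nonneg_left hn.le h0.le
  linarith

/-- First order expansion, as a two-sided estimate at increments shorter than some `ρ`. -/
theorem exists_abs_sub_le_of_hasDerivAt {f : ℝ → ℝ} {f' x ε : ℝ} (hf : HasDerivAt f f' x)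
    (hε : 0 < ε) : ∃ ρ > 0, ∀ r : ℝ, |r| < ρ → |f (x + r) - f x - r * f'| ≤ ε * |r| := by
  have := (hasDerivAt_iff_isLittleO_nhds_zero.1 hf).def hε
  obtain ⟨ρ, hρ, h⟩ := Metric.eventually_nhds_iff.1 this
  refine ⟨ρ, hρ, fun r hr => ?_⟩
  simpa using h (y := r) (by simpa using hr)

/-- The tangent to `τ` at `q` lies below `τ`, by convexity along the segment from `q` to `s`. -/
theorem HasWeights.tangent_le_tau {μ : Measure Cantor} {P : ℕ → Fin 2 → ℝ} (h : HasWeights μ P)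
    {q l α : ℝ} (hq : 0 < q) (hlim : Tendsto (fun n => tauN μ n q) atTop (𝓝 l))
    (hderiv : HasDerivAt (fun s => (tau μ s).toReal) (-α) q) (s : ℝ) :
    ((l - α * (s - q) : ℝ) : EReal) ≤ tau μ s := by
  refine EReal.le_of_forall_lt_iff_le.1 fun c hc => EReal.coe_le_coe_iff.2 ?_
  refine le_of_forall_pos_le_add fun η hη => ?_
  have hk : 0 < |s - q| + 1 := by positivity
  obtain ⟨ρ, hρ, hexp⟩ := exists_abs_sub_le_of_hasDerivAt hderiv (div_pos hη hk)
  -- a parameter `t` with `t |s - q|` smaller than `ρ` and than `q`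
  obtain ⟨t, ht0, ht⟩ : ∃ t, 0 < t ∧ t < min (1 / 2) (min ρ q / (|s - q| + 1)) :=
    exists_between (lt_min (by norm_num) (div_pos (lt_min hρ hq) hk))
  have ht1 : t < 1 / 2 := ht.trans_le (min_le_left _ _)
  have ht2 : t * (|s - q| + 1) < min ρ q := (lt_div_iff₀ hk).1 (ht.trans_le (min_le_right _ _))
  have habs : |t * (s - q)| = t * |s - q| := by rw [abs_mul, abs_of_pos ht0]
  have hlt : |t * (s - q)| < min ρ q := by rw [habs]; nlinarith
  have hexp' := hexp _ (hlt.trans_le (min_le_left _ _))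
  have hconv := h.tau_convex_le hlim hc ht0 (by linarith)
  have hpt : (1 - t) * q + t * s = q + t * (s - q) := by ring
  have hpos : 0 ≤ q + t * (s - q) := by
    have := neg_abs_le (t * (s - q))
    have := hlt.trans_le (min_le_right _ _)
    linarith
  rw [hpt, ← h.coe_toReal_tau hpos, EReal.coe_le_coe_iff] at hconv
  have hl : (tau μ q).toReal = l := by rw [tau_eq_of_tendsto hlim, EReal.toReal_coe]
  simp only [hl] at hexp'
  rw [habs] at hexp'
  have hexp'' := (abs_le.1 hexp').1
  have hη' : η / (|s - q| + 1) * (t * |s - q|) ≤ t * η := by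
    rw [div_mul_eq_mul_div, div_le_iff₀ hk]
    nlinarith [mul_pos hη ht0]
  have : t * (l - α * (s - q)) ≤ t * (c + η) := by linarith
  exact le_of_mul_le_mul_left this ht0

/-! ### Exponential estimates -/

theorem summable_two_rpow {b : ℕ → ℝ} {η : ℝ} (hη : 0 < η) (hb : ∀ᶠ n in atTop, b n ≤ -η) :
    Summable fun n : ℕ => (2 : ℝ) ^ (n * b n) := by
  have hg : Summable fun n : ℕ => ((2 : ℝ) ^ (-η)) ^ n :=
    summable_geometric_of_lt_one (by positivity)
      (Real.rpow_lt_one_of_one_lt_of_neg one_lt_two (by linarith))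
  refine hg.of_norm_bounded_eventually_nat ?_
  filter_upwards [hb] with n hn
  rw [Real.norm_of_nonneg (by positivity), ← Real.rpow_mul_natCast two_pos.le, mul_comm (-η)]
  exact Real.rpow_le_rpow_of_exponent_le one_le_two
    (mul_le_mul_of_nonneg_left hn (Nat.cast_nonneg n))

theorem two_inv_pow_rpow (n : ℕ) (d : ℝ) :
    ((2⁻¹ : ℝ≥0∞) ^ n) ^ d = ENNReal.ofReal (2 ^ (-(n * d))) := by
  rw [← ENNReal.rpow_natCast_mul, ENNReal.inv_rpow, ← ENNReal.rpow_neg,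
    ← ENNReal.ofReal_rpow_of_pos two_pos, ENNReal.ofReal_ofNat]

section
variable {μ ν : Measure Cantor} {P : ℕ → Fin 2 → ℝ} {q l α : ℝ}

theorem HasWeights.gibbs_cylinder (h : HasWeights μ P)
    (hν : IsGibbsMeasure ν P q) (n : ℕ) (ε : Fin n → Fin 2) :
    ν (wordCylinder ε) = ENNReal.ofReal (2 ^ (-(n * (q * wordExponent P ε + tauN μ n q)))) := by
  rw [hν, h.partitionSum_eq_rpow, wordWeight_eq_rpow h.pos, ← Real.rpow_mul two_pos.le,
    ← Real.rpow_sub two_pos]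
  congr 2
  ring

/-- Markov's inequality for `μ(I_n(x))^r` and the Gibbs measure, whose exponential moments are
quotients of partition sums. -/
theorem HasWeights.gibbs_tail_le (h : HasWeights μ P)
    (hν : IsGibbsMeasure ν P q) (r c : ℝ) (n : ℕ) :
    ν {x : Cantor | c ≤ -r * wordExponent P (fun j : Fin n => x j)} ≤
      ENNReal.ofReal (2 ^ (n * (tauN μ n (q + r) - tauN μ n q - c))) := by
  classical
  let A : Finset (Fin n → Fin 2) := {ε | c ≤ -r * wordExponent P ε}
  have hsub : {x : Cantor | c ≤ -r * wordExponent P (fun j : Fin n => x j)} ⊆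
      ⋃ ε ∈ A, wordCylinder ε := fun x hx =>
    Set.mem_iUnion₂.2 ⟨fun j => x j, by simpa [A] using hx, fun _ => rfl⟩
  refine (measure_mono hsub).trans ((measure_biUnion_finset_le _ _).trans ?_)
  have hterm : ∀ ε ∈ A, ν (wordCylinder ε) ≤
      ENNReal.ofReal (wordWeight P ε ^ (q + r) * 2 ^ (n * (-tauN μ n q - c))) := fun ε hε => by
    rw [h.gibbs_cylinder hν, wordWeight_eq_rpow h.pos, ← Real.rpow_mul two_pos.le,
      ← Real.rpow_add two_pos]
    refine ENNReal.ofReal_le_ofReal (Real.rpow_le_rpow_of_exponent_le one_le_two ?_)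
    have hc : c ≤ -r * wordExponent P ε := by simpa [A] using hε
    have := mul_le_mul_of_nonneg_left hc (Nat.cast_nonneg (α := ℝ) n)
    linarith
  refine (Finset.sum_le_sum hterm).trans ?_
  have hnn : ∀ ε : Fin n → Fin 2,
      0 ≤ wordWeight P ε ^ (q + r) * (2 : ℝ) ^ (n * (-tauN μ n q - c)) := fun ε =>
    mul_nonneg (Real.rpow_nonneg (wordWeight_pos h.pos ε).le _) (by positivity)
  rw [← ENNReal.ofReal_sum_of_nonneg fun ε _ => hnn ε]
  refine ENNReal.ofReal_le_ofReal
    ((Finset.sum_le_sum_of_subset_of_nonneg (Finset.subset_univ A) fun ε _ _ => hnn ε).trans ?_)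
  rw [← Finset.sum_mul, ← partitionSum, h.partitionSum_eq_rpow, ← Real.rpow_add two_pos]
  refine le_of_eq ?_
  congr 1
  ring

/-- The Borel–Cantelli lemma applied to `gibbs_tail_le`, whose bounds decay exponentially as soon as
`τ(q + r) < τ(q) + c`. -/
theorem HasWeights.ae_eventually_lt (h : HasWeights μ P)
    (hν : IsGibbsMeasure ν P q) (hlim : Tendsto (fun n => tauN μ n q) atTop (𝓝 l)) {r c : ℝ}
    (hc : tau μ (q + r) < ((l + c : ℝ) : EReal)) :
    ∀ᵐ x ∂ν, ∀ᶠ n : ℕ in atTop, -r * wordExponent P (fun j : Fin n => x j) < c := by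
  obtain ⟨z, hz, hzc⟩ := EReal.lt_iff_exists_real_btwn.1 hc
  rw [EReal.coe_lt_coe_iff] at hzc
  have hη : 0 < (l + c - z) / 2 := by linarith
  have hsum : Summable fun n : ℕ => (2 : ℝ) ^ (n * (tauN μ n (q + r) - tauN μ n q - c)) := by
    refine summable_two_rpow hη ?_
    filter_upwards [eventually_tauN_lt hz, hlim.eventually_const_lt (sub_lt_self l hη)]
      with n h1 h2
    linarith
  have := ae_eventually_notMem (μ := ν) (ne_top_of_le_ne_top hsum.tsum_ofReal_ne_top
    (ENNReal.tsum_le_tsum (h.gibbs_tail_le hν r c)))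
  filter_upwards [this] with x hx
  filter_upwards [hx] with n hn
  exact not_le.1 hn

/-- Law of large numbers: the Gibbs measure at `q` is carried by the points of local
dimension `-τ'(q)`. -/
theorem HasWeights.ae_tendsto_wordExponent (h : HasWeights μ P) (hq : 0 < q)
    (hν : IsGibbsMeasure ν P q) (hlim : Tendsto (fun n => tauN μ n q) atTop (𝓝 l))
    (hderiv : HasDerivAt (fun s => (tau μ s).toReal) (-α) q) :
    ∀ᵐ x ∂ν, Tendsto (fun n : ℕ => wordExponent P (fun j : Fin n => x j)) atTop (𝓝 α) := by
  have hl : (tau μ q).toReal = l := by rw [tau_eq_of_tendsto hlim, EReal.toReal_coe]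
  have key : ∀ k : ℕ, ∀ᵐ x ∂ν, ∀ᶠ n : ℕ in atTop,
      |wordExponent P (fun j : Fin n => x j) - α| < 1 / ((k : ℝ) + 1) := fun k => by
    have hε : 0 < 1 / ((k : ℝ) + 1) := by positivity
    set ε := 1 / ((k : ℝ) + 1)
    obtain ⟨ρ, hρ, hexp⟩ := exists_abs_sub_le_of_hasDerivAt hderiv (half_pos hε)
    -- increments `r` and `-r` give the lower and the upper bound on the exponent respectively
    obtain ⟨r, hr0, hr⟩ : ∃ r, 0 < r ∧ r < min ρ q := exists_between (lt_min hρ hq)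
    have hrρ := hr.trans_le (min_le_left _ _)
    have hrq := hr.trans_le (min_le_right _ _)
    have up := (abs_le.1 (hexp r (by rwa [abs_of_pos hr0]))).2
    have down := (abs_le.1 (hexp (-r) (by rwa [abs_neg, abs_of_pos hr0]))).2
    rw [abs_of_pos hr0] at up
    rw [abs_neg, abs_of_pos hr0] at down
    have hrε := mul_pos hr0 hε
    have h1 := h.ae_eventually_lt hν hlim (r := r) (c := r * (-α + ε)) (by
      rw [← h.coe_toReal_tau (by linarith), EReal.coe_lt_coe_iff]
      simp only [hl] at up
      linarith)
    have h2 := h.ae_eventually_lt hν hlim (r := -r) (c := r * (α + ε)) (by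
      rw [← h.coe_toReal_tau (by linarith), EReal.coe_lt_coe_iff]
      simp only [hl] at down
      linarith)
    filter_upwards [h1, h2] with x hx1 hx2
    filter_upwards [hx1, hx2] with n hn1 hn2
    rw [abs_lt]
    constructor <;> nlinarith
  filter_upwards [ae_all_iff.2 key] with x hx
  rw [Metric.tendsto_atTop]
  intro ε hε
  obtain ⟨k, hk⟩ := exists_nat_one_div_lt hε
  obtain ⟨N, hN⟩ := eventually_atTop.1 (hx k)
  exact ⟨N, fun n hn => (hN n hn).trans hk⟩

theorem HasWeights.mem_levelSets_of_tendsto (h : HasWeights μ P) {x : Cantor}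
    (hx : Tendsto (fun n : ℕ => wordExponent P (fun j : Fin n => x j)) atTop (𝓝 α)) :
    x ∈ levelSetE μ α ∩ levelSetF μ α := by
  have : Tendsto (fun n => alphaN μ n x) atTop (𝓝 (α : EReal)) := by
    simp only [h.alphaN_eq]
    exact (continuous_coe_real_ereal.tendsto α).comp hx
  exact ⟨this.liminf_eq, this.limsup_eq⟩

/-! ### The two dimension estimates -/

/-- The Gibbs measure at `q` is carried by `E_α ∩ F_α`, and has local dimension `α q + τ(q)`
at almost every point. -/
theorem HasWeights.le_hausdorffDim_levelSets (h : HasWeights μ P) (hq : 0 < q)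
    (hlim : Tendsto (fun n => tauN μ n q) atTop (𝓝 l))
    (hderiv : HasDerivAt (fun s => (tau μ s).toReal) (-α) q) :
    0 ≤ α * q + l ∧
      ENNReal.ofReal (α * q + l) ≤ hausdorffDim (levelSetE μ α ∩ levelSetF μ α) := by
  obtain ⟨ν, hprob, hν⟩ := exists_gibbsMeasure h.pos q
  have hae := h.ae_tendsto_wordExponent hq hν hlim hderiv
  have hloc : ∀ x : Cantor,
      Tendsto (fun n : ℕ => wordExponent P (fun j : Fin n => x j)) atTop (𝓝 α) →
      Tendsto (fun n : ℕ => q * wordExponent P (fun j : Fin n => x j) + tauN μ n q) atTop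
        (𝓝 (α * q + l)) := fun x hx => by
    rw [mul_comm α q]
    exact (hx.const_mul q).add hlim
  constructor
  · obtain ⟨x, hx⟩ := hae.exists
    refine ge_of_tendsto (hloc x hx) ?_
    filter_upwards [eventually_gt_atTop 0] with n hn
    have hle : ν (wordCylinder fun j : Fin n => x j) ≤ 1 := prob_le_one
    rw [h.gibbs_cylinder hν, ENNReal.ofReal_le_one, ← Real.rpow_zero 2,
      Real.rpow_le_rpow_left_iff one_lt_two] at hle
    have hn' : (0 : ℝ) < n := by positivity
    by_contra! hneg
    nlinarith
  · refine le_of_forall_lt fun d hd => ?_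
    obtain ⟨d', hdd', hd'⟩ := ENNReal.lt_iff_exists_nnreal_btwn.1 hd
    refine hdd'.trans_le ?_
    have hd'' : (d' : ℝ) < α * q + l := by
      rw [← ENNReal.ofReal_coe_nnreal, ENNReal.ofReal_lt_ofReal_iff'] at hd'
      exact hd'.1
    set s := {x : Cantor |
      Tendsto (fun n : ℕ => wordExponent P (fun j : Fin n => x j)) atTop (𝓝 α)}
    have hs : ν s ≠ 0 := by
      have : ν s = ν Set.univ := measure_eq_measure_of_null_sdiff (Set.subset_univ _) (by
        rw [← Set.compl_eq_univ_sdiff]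
        exact hae)
      rw [this, measure_univ]
      exact one_ne_zero
    refine (le_hausdorffDim_of_measure_cylinderAt_le hs fun x hx => ?_).trans
      (hausdorffDim_mono fun x hx => h.mem_levelSets_of_tendsto hx)
    filter_upwards [(hloc x hx).eventually_const_lt hd''] with n hn
    rw [cylinderAt, h.gibbs_cylinder hν, two_inv_pow_rpow]
    refine ENNReal.ofReal_le_ofReal (Real.rpow_le_rpow_of_exponent_le one_le_two ?_)
    have := mul_le_mul_of_nonneg_left hn.le (Nat.cast_nonneg (α := ℝ) n)
    linarith

/-- Points of `E_α` lie in infinitely many cylinders with exponent at most `α + δ`, and at most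
`2 ^ (n (q (α + δ) + τ_n(q)))` words of length `n` have such an exponent. -/
theorem HasWeights.hausdorffDim_levelSetE_le (h : HasWeights μ P) (hq : 0 < q)
    (hlim : Tendsto (fun n => tauN μ n q) atTop (𝓝 l)) :
    hausdorffDim (levelSetE μ α) ≤ ENNReal.ofReal (α * q + l) := by
  classical
  refine le_of_forall_gt fun d hd => ?_
  obtain ⟨d', hd', hdd'⟩ := ENNReal.lt_iff_exists_nnreal_btwn.1 hd
  refine lt_of_le_of_lt ?_ hdd'
  have hd'' : α * q + l < d' := by
    rw [← ENNReal.ofReal_coe_nnreal, ENNReal.ofReal_lt_ofReal_iff'] at hd'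
    exact hd'.1
  set δ := (d' - (α * q + l)) / (2 * q) with hδ
  have hδ0 : 0 < δ := div_pos (by linarith) (by linarith)
  have hqδ : q * δ = (d' - (α * q + l)) / 2 := by rw [hδ]; field_simp
  let W : ∀ n : ℕ, Finset (Fin n → Fin 2) := fun n => {ε | wordExponent P ε ≤ α + δ}
  refine hausdorffDim_le_of_cover W (fun x hx => ?_) ?_
  · have hlt : liminf (fun n => alphaN μ n x) atTop < ((α + δ : ℝ) : EReal) := by
      rw [show liminf (fun n => alphaN μ n x) atTop = (α : EReal) from hx, EReal.coe_lt_coe_iff]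
      linarith
    refine (frequently_lt_of_liminf_lt (by isBoundedDefault) hlt).mono fun n hn => ?_
    rw [h.alphaN_eq, EReal.coe_lt_coe_iff] at hn
    simpa [W] using hn.le
  · have hsum : Summable fun n : ℕ => (2 : ℝ) ^ (n * (q * (α + δ) + tauN μ n q - d')) := by
      refine summable_two_rpow (η := q * δ / 2) (by positivity) ?_
      filter_upwards [hlim.eventually_lt_const
        (show l < l + q * δ / 2 by linarith [mul_pos hq hδ0])] with n hn
      linarith
    refine ne_top_of_le_ne_top hsum.tsum_ofReal_ne_top (ENNReal.tsum_le_tsum fun n => ?_)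
    rw [two_inv_pow_rpow, ← ENNReal.ofReal_natCast, ← ENNReal.ofReal_mul (Nat.cast_nonneg _)]
    refine ENNReal.ofReal_le_ofReal ?_
    -- every word counted contributes at least `2 ^ (-n q (α + δ))` to the partition sum
    have hcount : ((W n).card : ℝ) * 2 ^ (-(n * (q * (α + δ)))) ≤ 2 ^ (n * tauN μ n q) := by
      rw [← h.partitionSum_eq_rpow, ← nsmul_eq_mul]
      refine (Finset.card_nsmul_le_sum (W n) (fun ε => wordWeight P ε ^ q) _ fun ε hε => ?_).trans
        (Finset.sum_le_sum_of_subset_of_nonneg (Finset.subset_univ _) fun ε _ _ =>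
          Real.rpow_nonneg (wordWeight_pos h.pos ε).le _)
      have hε' : wordExponent P ε ≤ α + δ := by simpa [W] using hε
      rw [wordWeight_eq_rpow h.pos, ← Real.rpow_mul two_pos.le]
      refine Real.rpow_le_rpow_of_exponent_le one_le_two ?_
      have := mul_le_mul_of_nonneg_left hε' (mul_nonneg (Nat.cast_nonneg (α := ℝ) n) hq.le)
      linarith
    calc ((W n).card : ℝ) * 2 ^ (-(n * (d' : ℝ)))
        = ((W n).card : ℝ) * 2 ^ (-(n * (q * (α + δ)))) * 2 ^ (n * (q * (α + δ) - d')) := by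
          rw [mul_assoc, ← Real.rpow_add two_pos]
          congr 2
          ring
      _ ≤ 2 ^ (n * tauN μ n q) * 2 ^ (n * (q * (α + δ) - d')) :=
          mul_le_mul_of_nonneg_right hcount (by positivity)
      _ = _ := by
          rw [← Real.rpow_add two_pos]
          congr 1
          ring

theorem HasWeights.tauStar_eq (h : HasWeights μ P) (hq : 0 < q)
    (hlim : Tendsto (fun n => tauN μ n q) atTop (𝓝 l))
    (hderiv : HasDerivAt (fun s => (tau μ s).toReal) (-α) q) :
    tauStar μ α = ((α * q + l : ℝ) : EReal) := by
  refine le_antisymm ((iInf_le _ q).trans ?_) (le_iInf fun s => ?_)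
  · rw [tau_eq_of_tendsto hlim, EReal.coe_add]
  · refine le_trans (le_of_eq ?_) (add_le_add_right (h.tangent_le_tau hq hlim hderiv s) _)
    rw [← EReal.coe_add]
    congr 1
    ring

end

end BernoulliProduct

theorem theorem1p2
    (μ : MeasureTheory.Measure BernoulliProduct.Cantor)
    (hμ : BernoulliProduct.IsInhomogeneousBernoulliProduct μ)
    (q : ℝ) (hq : 0 < q)
    (hconv : ∃ l : ℝ,
      Filter.Tendsto (fun n => BernoulliProduct.tauN μ n q) Filter.atTop (nhds l))
    (hdiff : DifferentiableAt ℝ (fun s => (BernoulliProduct.tau μ s).toReal) q)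
    (α : ℝ) (hα : α = -deriv (fun s => (BernoulliProduct.tau μ s).toReal) q) :
    ((BernoulliProduct.hausdorffDim
        (BernoulliProduct.levelSetE μ α ∩ BernoulliProduct.levelSetF μ α) : ENNReal) : EReal)
        = BernoulliProduct.tauStar μ α ∧
      BernoulliProduct.tauStar μ α = ((α * q : ℝ) : EReal) + BernoulliProduct.tau μ q ∧
      ((BernoulliProduct.hausdorffDim (BernoulliProduct.levelSetE μ α) : ENNReal) : EReal)
        = BernoulliProduct.tauStar μ α := by
  obtain ⟨P, h⟩ := hμ.exists_hasWeights
  obtain ⟨l, hlim⟩ := hconv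
  have hderiv : HasDerivAt (fun s => (BernoulliProduct.tau μ s).toReal) (-α) q := by
    rw [hα, neg_neg]
    exact hdiff.hasDerivAt
  have hstar := h.tauStar_eq hq hlim hderiv
  obtain ⟨hnonneg, hlower⟩ := h.le_hausdorffDim_levelSets hq hlim hderiv
  have hupper := h.hausdorffDim_levelSetE_le (α := α) hq hlim
  have hmono : BernoulliProduct.hausdorffDim
      (BernoulliProduct.levelSetE μ α ∩ BernoulliProduct.levelSetF μ α) ≤
      BernoulliProduct.hausdorffDim (BernoulliProduct.levelSetE μ α) :=
    BernoulliProduct.hausdorffDim_mono Set.inter_subset_left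
  have hcoe : ((ENNReal.ofReal (α * q + l) : ENNReal) : EReal) = ((α * q + l : ℝ) : EReal) := by
    rw [EReal.coe_ennreal_ofReal, max_eq_left hnonneg]
  rw [hstar, ← hcoe]
  refine ⟨?_, ?_, ?_⟩
  · rw [le_antisymm (hmono.trans hupper) hlower]
  · rw [hcoe, BernoulliProduct.tau_eq_of_tendsto hlim, EReal.coe_add]
  · rw [le_antisymm hupper (hlower.trans hmono)]
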